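/- Let $\mathcal{S},\mathcal{A}$ be measurable spaces (states and actions), let $\pi(\cdot\mid s)$ be a policy (a Markov kernel from $\mathcal{S}$ to $\mathcal{A}$), let $\gamma\in[0,1)$, and for each $(s,a)$ let the pair of the reward $R(s,a)\in\mathbb{R}$ and the next state $s'\sim P(\cdot\mid s,a)$ have a given joint law depending measurably on $(s,a)$ (independence of reward and next state is allowed but not required). A return distribution $Z$ assigns to every $(s,a)$ a probability measure $Z(s,a)$ on $\mathbb{R}$, measurably in $(s,a)$. The distributional Bellman operator $\mathfrak{T}^\pi$ is defined by letting $(\mathfrak{T}^\pi Z)(s,a)$ be the law of $R(s,a)+\gamma z$, where, given the reward and $s'$, $a'\sim\pi(\cdot\mid s')$ and $z\sim Z(s',a')$. Put $$D_{\mathrm{KL}}^\infty(Z_1,Z_2)=\sup_{(s,a)}D_{\mathrm{KL}}(Z_1(s,a),Z_2(s,a))\in[0,\infty],$$ let $W_p$ denote the $p$-Wasserstein distance on $\mathbb{R}$, write $\mathbb{E}Z$ for the function $(s,a)\mapsto\int z\,Z(s,a)(\mathrm{d}z)$, and let $\|\cdot\|_\infty\in[0,\infty]$ be the sup norm over $\mathcal{S}\times\mathcal{A}$.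 Then: (1) $D_{\mathrm{KL}}^\infty(\mathfrak{T}^\pi Z_1,\mathfrak{T}^\pi Z_2)\le D_{\mathrm{KL}}^\infty(Z_1,Z_2)$ for all return distributions $Z_1,Z_2$. (2) Let $\mathcal{X}\subset\mathbb{R}$ be compact and $1\le p<\infty$. If all $Z_n(s,a)$ and $Z(s,a)$ are supported in $\mathcal{X}$ and $D_{\mathrm{KL}}^\infty(Z_n,Z)\to0$, then $\sup_{(s,a)}W_p(Z_n(s,a),Z(s,a))\to0$. (3) If all the laws $Z_i(s,a)$ and $(\mathfrak{T}^\pi Z_i)(s,a)$, $i=1,2$, have expectations, then $$\|\mathbb{E}\,\mathfrak{T}^\pi Z_1-\mathbb{E}\,\mathfrak{T}^\pi Z_2\|_\infty\le\gamma\,\|\mathbb{E}Z_1-\mathbb{E}Z_2\|_\infty$$ (with $0\cdot\infty=0$). The expectations of $Z$ and $\mathfrak{T}^\pi Z$ exist at every $(s,a)$ whenever $\mathbb{E}|R(s,a)|<\infty$ for all $(s,a)$ and $\sup_{(s,a)}\int|z|\,Z(s,a)(\mathrm{d}z)<\infty$. -/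

import Mathlib

open MeasureTheory ProbabilityTheory Filter Topology
open scoped ENNReal

namespace DistRL

noncomputable section

/-- A coupling of `μ` and `ν`: a measure on the product with marginals `μ` and `ν`. -/
def IsCoupling {E : Type*} [MeasurableSpace E] (c : Measure (E × E)) (μ ν : Measure E) : Prop :=
  c.map Prod.fst = μ ∧ c.map Prod.snd = ν

/-- The `p`-Wasserstein distance
`W_p(μ, ν) = (inf over couplings c of ∫ d(x, y) ^ p dc(x, y)) ^ (1 / p)`, for `1 ≤ p < ∞`. -/
def wasserstein {E : Type*} [PseudoEMetricSpace E] [MeasurableSpace E]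
    (p : ℝ) (μ ν : Measure E) : ℝ≥0∞ :=
  (⨅ (c : Measure (E × E)) (_ : IsCoupling c μ ν), ∫⁻ z, edist z.1 z.2 ^ p ∂c) ^ (1 / p)

/-- The supremum over state-action pairs of the Kullback-Leibler divergence
`D_KL(Z₁(s, a), Z₂(s, a))`. -/
def klSup {S A : Type*} [MeasurableSpace S] [MeasurableSpace A]
    (Z₁ Z₂ : Kernel (S × A) ℝ) : ℝ≥0∞ :=
  ⨆ x : S × A, InformationTheory.klDiv (Z₁ x) (Z₂ x)

/-- The supremum over state-action pairs of the `p`-Wasserstein distance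
`W_p(Z₁(s, a), Z₂(s, a))`. -/
def wassersteinSup {S A : Type*} [MeasurableSpace S] [MeasurableSpace A]
    (p : ℝ) (Z₁ Z₂ : Kernel (S × A) ℝ) : ℝ≥0∞ :=
  ⨆ x : S × A, wasserstein p (Z₁ x) (Z₂ x)

/-- The law of the return from the random next pair: for a state `s'`, draw `a' ∼ π(· | s')`
and then `z ∼ Z(s', a')`. -/
def nextReturn {S A : Type*} [MeasurableSpace S] [MeasurableSpace A]
    (π : Kernel S A) (Z : Kernel (S × A) ℝ) : Kernel S ℝ :=
  Z ∘ₖ (Kernel.id ×ₖ π)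

/-- The distributional Bellman operator of the policy `π`. Here `K (s, a)` is the joint law of the
reward `R(s, a)` and the next state `s'`. The value at `(s, a)` is the law of `r + γ * z`, where
`(r, s') ∼ K (s, a)` and, given these, `a' ∼ π(· | s')` and `z ∼ Z(s', a')`. -/
def distBellman {S A : Type*} [MeasurableSpace S] [MeasurableSpace A]
    (K : Kernel (S × A) (ℝ × S)) (π : Kernel S A) (γ : ℝ) (Z : Kernel (S × A) ℝ) :
    Kernel (S × A) ℝ :=
  (K ⊗ₖ Kernel.prodMkLeft (S × A) ((nextReturn π Z).comap Prod.snd measurable_snd)).map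
    (fun q : (ℝ × S) × ℝ => q.1.1 + γ * q.2)

/-- Every `Z(s, a)` has an expectation. -/
def HasMean {S A : Type*} [MeasurableSpace S] [MeasurableSpace A]
    (Z : Kernel (S × A) ℝ) : Prop :=
  ∀ x : S × A, Integrable (fun z : ℝ => z) (Z x)

/-- The expectation `𝔼 Z`, a real function of the state-action pair. -/
def mean {S A : Type*} [MeasurableSpace S] [MeasurableSpace A]
    (Z : Kernel (S × A) ℝ) (x : S × A) : ℝ :=
  ∫ z, z ∂(Z x)

/-- The sup norm of a real function, with value `∞` for an unbounded function. -/
def supNorm {X : Type*} (f : X → ℝ) : ℝ≥0∞ :=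
  ⨆ x : X, ‖f x‖ₑ

end

end DistRL

/-! The law of the pair (reward, next state-action pair) does not involve `Z`. So `distBellman K π γ
Z x` is a push-forward of the joint law of that pair and `z`, and `Z` enters only as the last
conditional law (`distBellman_apply_eq_map`).

(1) Data processing removes the push-forward. With a shared first marginal, the divergence of the
joint laws is the average of the fibrewise divergences, hence at most their supremum
(`klDiv_compProd_right_le`).

(2) Small divergence forces small total variation (`lintegral_one_sub_rnDeriv_le`). A coupling that
moves only the non-common mass, inside a bounded set, turns this into a Wasserstein bound
(`wasserstein_le`). Both bounds are uniform in the state-action pair.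

(3) By Fubini the mean is an average of `r + γ * mean Z`; in a difference the rewards cancel
pointwise. -/

namespace DistRL

/-! ### Divergence of joint laws with a common first marginal -/

section KullbackLeibler

variable {X Y : Type*} [MeasurableSpace X] [MeasurableSpace Y]
  [MeasurableSpace.CountableOrCountablyGenerated X Y]

lemma compProd_eq_withDensity_rnDeriv (μ : Measure X) [SFinite μ] (κ η : Kernel X Y)
    [IsFiniteKernel κ] [IsFiniteKernel η] (h : ∀ x, κ x ≪ η x) :
    μ ⊗ₘ κ = (μ ⊗ₘ η).withDensity (fun q => κ.rnDeriv η q.1 q.2) := by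
  have hm : Measurable fun q : X × Y => κ.rnDeriv η q.1 q.2 := Kernel.measurable_rnDeriv κ η
  refine Measure.ext_of_lintegral _ fun f hf => ?_
  rw [lintegral_withDensity_eq_lintegral_mul _ hm hf, Measure.lintegral_compProd hf,
    Measure.lintegral_compProd (hm.mul hf)]
  refine lintegral_congr fun x => ?_
  have hx : κ x = (η x).withDensity (κ.rnDeriv η x) := by
    rw [← Kernel.withDensity_apply _ (Kernel.measurable_rnDeriv κ η),
      Kernel.withDensity_rnDeriv_eq (h x)]
  rw [hx]
  exact lintegral_withDensity_eq_lintegral_mul _ (Kernel.measurable_rnDeriv_right κ η x)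
    (hf.comp measurable_prodMk_left)

/-- The jointly measurable kernel derivative is a density of one joint law with respect to the
other, so Tonelli splits the integral of `klFun` over the fibres. -/
lemma klDiv_compProd_right (μ : Measure X) [IsFiniteMeasure μ] (κ η : Kernel X Y)
    [IsFiniteKernel κ] [IsFiniteKernel η] (h : ∀ x, κ x ≪ η x) :
    InformationTheory.klDiv (μ ⊗ₘ κ) (μ ⊗ₘ η)
      = ∫⁻ x, InformationTheory.klDiv (κ x) (η x) ∂μ := by
  have hm : Measurable fun q : X × Y => κ.rnDeriv η q.1 q.2 := Kernel.measurable_rnDeriv κ η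
  have hd : (μ ⊗ₘ κ).rnDeriv (μ ⊗ₘ η) =ᵐ[μ ⊗ₘ η] fun q => κ.rnDeriv η q.1 q.2 := by
    rw [compProd_eq_withDensity_rnDeriv μ κ η h]
    exact Measure.rnDeriv_withDensity _ hm
  rw [InformationTheory.klDiv_eq_lintegral_klFun_of_ac
    (Measure.AbsolutelyContinuous.compProd_right (ae_of_all _ h))]
  have hk : Measurable fun q : X × Y =>
      ENNReal.ofReal (InformationTheory.klFun (κ.rnDeriv η q.1 q.2).toReal) := by fun_prop
  refine (lintegral_congr_ae (hd.fun_comp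
    fun t => ENNReal.ofReal (InformationTheory.klFun t.toReal))).trans ?_
  refine (Measure.lintegral_compProd hk).trans ?_
  refine lintegral_congr fun x => ?_
  rw [InformationTheory.klDiv_eq_lintegral_klFun_of_ac (h x)]
  exact lintegral_congr_ae ((Kernel.rnDeriv_eq_rnDeriv_measure (κ := κ) (η := η)).fun_comp
    fun t => ENNReal.ofReal (InformationTheory.klFun t.toReal))

lemma klDiv_compProd_right_le (μ : Measure X) [IsProbabilityMeasure μ] (κ η : Kernel X Y)
    [IsFiniteKernel κ] [IsFiniteKernel η] {C : ℝ≥0∞}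
    (hC : ∀ x, InformationTheory.klDiv (κ x) (η x) ≤ C) :
    InformationTheory.klDiv (μ ⊗ₘ κ) (μ ⊗ₘ η) ≤ C := by
  rcases eq_or_ne C ∞ with rfl | hC'
  · exact le_top
  have hac : ∀ x, κ x ≪ η x := fun x =>
    (InformationTheory.klDiv_ne_top_iff.1 ((hC x).trans_lt hC'.lt_top).ne).1
  rw [klDiv_compProd_right μ κ η hac]
  calc ∫⁻ x, InformationTheory.klDiv (κ x) (η x) ∂μ ≤ ∫⁻ _, C ∂μ := lintegral_mono hC
    _ = C := by simp

end KullbackLeibler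

/-! ### From divergence to total variation -/

section TotalVariation

/-- The Hellinger lower bound on `klFun`. -/
lemma sq_sqrt_sub_one_le_klFun {x : ℝ} (hx : 0 ≤ x) :
    (√x - 1) ^ 2 ≤ InformationTheory.klFun x := by
  rcases hx.eq_or_lt with rfl | hx
  · simp [InformationTheory.klFun_zero]
  have hs : 0 < √x := Real.sqrt_pos.2 hx
  have hsq : √x ^ 2 = x := Real.sq_sqrt hx.le
  -- Applying `log t ≥ 1 - 1/t` at `t = √x` rather than at `x` leaves exactly the square.
  have hl : Real.log x = 2 * Real.log (√x) := by
    rw [Real.log_sqrt hx.le]; ring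
  have h1 : 1 - (√x)⁻¹ ≤ Real.log (√x) := Real.one_sub_inv_le_log_of_pos hs
  have h2 : x * (1 - (√x)⁻¹) ≤ x * Real.log (√x) := by gcongr
  have h3 : x * (√x)⁻¹ = √x := by
    field_simp; exact hsq.symm
  rw [InformationTheory.klFun_apply, hl]
  nlinarith

/-- With `t = 1 - √x`, `1 - x = 2t - t² ≤ 2t ≤ ε + t²/ε`, and `t²` is at most `klFun x`. -/
lemma one_sub_le_add_klFun_div {x ε : ℝ} (hx : 0 ≤ x) (hε : 0 < ε) :
    1 - x ≤ ε + InformationTheory.klFun x / ε := by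
  have h := sq_sqrt_sub_one_le_klFun hx
  have hsq : √x ^ 2 = x := Real.sq_sqrt hx
  have h1 : (√x - 1) ^ 2 / ε ≤ InformationTheory.klFun x / ε := by gcongr
  have h2 : 1 - x ≤ ε + (√x - 1) ^ 2 / ε := by
    have h3 : (ε + (√x - 1) ^ 2 / ε) - 2 * (1 - √x) = (ε - (1 - √x)) ^ 2 / ε := by
      field_simp; ring
    have h4 : 0 ≤ (ε - (1 - √x)) ^ 2 / ε := by positivity
    nlinarith [sq_nonneg (√x - 1)]
  linarith

/-- A Pinsker type inequality: the total variation distance is small if the Kullback-Leibler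
divergence is. -/
lemma lintegral_one_sub_rnDeriv_le {E : Type*} [MeasurableSpace E] (μ ν : Measure E)
    [IsFiniteMeasure μ] [IsProbabilityMeasure ν] (h : μ ≪ ν) {ε : ℝ} (hε : 0 < ε) :
    ∫⁻ x, (1 - μ.rnDeriv ν x) ∂ν
      ≤ ENNReal.ofReal ε + InformationTheory.klDiv μ ν / ENNReal.ofReal ε := by
  rw [InformationTheory.klDiv_eq_lintegral_klFun_of_ac h, ENNReal.div_eq_inv_mul,
    ← lintegral_const_mul _ (by fun_prop)]
  calc ∫⁻ x, (1 - μ.rnDeriv ν x) ∂ν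
      ≤ ∫⁻ x, (ENNReal.ofReal ε + (ENNReal.ofReal ε)⁻¹ *
          ENNReal.ofReal (InformationTheory.klFun (μ.rnDeriv ν x).toReal)) ∂ν := by
        refine lintegral_mono_ae ?_
        filter_upwards [Measure.rnDeriv_ne_top μ ν] with x hx
        have hk := InformationTheory.klFun_nonneg (ENNReal.toReal_nonneg (a := μ.rnDeriv ν x))
        rw [← ENNReal.div_eq_inv_mul, ← ENNReal.ofReal_div_of_pos hε,
          ← ENNReal.ofReal_add hε.le (by positivity)]
        conv_lhs => rw [← ENNReal.ofReal_toReal hx, ← ENNReal.ofReal_one,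
          ← ENNReal.ofReal_sub _ ENNReal.toReal_nonneg]
        exact ENNReal.ofReal_le_ofReal (one_sub_le_add_klFun_div ENNReal.toReal_nonneg hε)
    _ = _ := by rw [lintegral_add_left measurable_const]; simp

end TotalVariation

/-! ### Couplings and Wasserstein convergence -/

section Wasserstein

/-- The coupling that keeps the common part of `μ` and `ν` in place. -/
lemma exists_coupling_lintegral_le {E : Type*} [PseudoEMetricSpace E] [MeasurableSpace E]
    (μ ν : Measure E) [IsProbabilityMeasure μ] [IsProbabilityMeasure ν] (h : μ ≪ ν)
    {s : Set E} (hs : ν sᶜ = 0) {p : ℝ} (hp : 0 < p) :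
    ∃ c : Measure (E × E), IsCoupling c μ ν ∧
      ∫⁻ z, edist z.1 z.2 ^ p ∂c
        ≤ Metric.ediam s ^ p * ∫⁻ x, (1 - μ.rnDeriv ν x) ∂ν := by
  set f := μ.rnDeriv ν with hf
  have hfm : Measurable f := Measure.measurable_rnDeriv μ ν
  set m := ν.withDensity fun x => min (f x) 1 with hm
  set μ' := ν.withDensity fun x => f x - 1 with hμ'
  set ν' := ν.withDensity fun x => 1 - f x with hν'
  set τ := ∫⁻ x, (1 - f x) ∂ν with hτ
  have hmμ : m + μ' = μ := by
    conv_rhs => rw [← Measure.withDensity_rnDeriv_eq μ ν h]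
    rw [hm, hμ', ← withDensity_add_left (by fun_prop)]
    congr 1 with x
    rcases le_total (f x) 1 with hx | hx
    · simp [hx, hf.symm, tsub_eq_zero_of_le hx]
    · simp [hx, hf.symm]
  have hmν : m + ν' = ν := by
    conv_rhs => rw [← withDensity_one (μ := ν)]
    rw [hm, hν', ← withDensity_add_left (by fun_prop)]
    congr 1 with x
    rcases le_total (f x) 1 with hx | hx
    · simp [hx]
    · simp [hx, tsub_eq_zero_of_le hx]
  have hν'u : ν' Set.univ = τ := by simp [hν', hτ]
  have hmfin : m Set.univ ≠ ∞ := by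
    refine ne_top_of_le_ne_top (measure_ne_top ν Set.univ) ?_
    conv_rhs => rw [← hmν]
    simp
  -- Surplus and deficit have equal mass: cancel the finite common part from two probability
  -- measures.
  have hμ'u : μ' Set.univ = τ := by
    rw [← hν'u]
    refine (ENNReal.add_right_inj hmfin).1 ?_
    rw [← Measure.add_apply, ← Measure.add_apply, hmμ, hmν]
    simp
  have hτfin : τ ≠ ∞ := by
    rw [← hν'u]
    refine ne_top_of_le_ne_top (measure_ne_top ν Set.univ) ?_
    conv_rhs => rw [← hmν]
    simp
  have : IsFiniteMeasure μ' := ⟨hμ'u ▸ hτfin.lt_top⟩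
  have : IsFiniteMeasure ν' := ⟨hν'u ▸ hτfin.lt_top⟩
  have hμ's : ∀ᵐ x ∂μ', x ∈ s :=
    (withDensity_absolutelyContinuous ν _).ae_le (ae_iff.2 hs)
  have hν's : ∀ᵐ x ∂ν', x ∈ s :=
    (withDensity_absolutelyContinuous ν _).ae_le (ae_iff.2 hs)
  have hdiag : Measurable fun x : E => (x, x) := measurable_id.prodMk measurable_id
  have hscale : ∀ ρ : Measure E, ρ Set.univ = τ → τ⁻¹ • τ • ρ = ρ := by
    intro ρ hρ
    rcases eq_or_ne τ 0 with h0 | h0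
    · rw [h0, Measure.measure_univ_eq_zero] at hρ
      simp [hρ]
    · rw [smul_smul, ENNReal.inv_mul_cancel h0 hτfin, one_smul]
  -- The common part stays on the diagonal; the leftovers are coupled independently. If `τ = 0` the
  -- factor `τ⁻¹` is `∞`, but the product is the zero measure.
  refine ⟨m.map (fun x => (x, x)) + τ⁻¹ • μ'.prod ν', ⟨?_, ?_⟩, ?_⟩
  · rw [Measure.map_add _ _ measurable_fst, Measure.map_map measurable_fst hdiag,
      Measure.map_smul, Measure.map_fst_prod, hν'u, hscale _ hμ'u]
    simpa [Function.comp_def] using hmμ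
  · rw [Measure.map_add _ _ measurable_snd, Measure.map_map measurable_snd hdiag,
      Measure.map_smul, Measure.map_snd_prod, hμ'u, hscale _ hν'u]
    simpa [Function.comp_def] using hmν
  · rw [lintegral_add_measure, lintegral_smul_measure]
    have h1 : ∫⁻ z, edist z.1 z.2 ^ p ∂(m.map fun x => (x, x)) = 0 := by
      refine le_antisymm ((lintegral_map_le _ _).trans ?_) bot_le
      simp [hp]
    have hae : ∀ᵐ z ∂(μ'.prod ν'), z.1 ∈ s ∧ z.2 ∈ s :=
      (Measure.quasiMeasurePreserving_fst.ae hμ's).and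
        (Measure.quasiMeasurePreserving_snd.ae hν's)
    have h2 : ∫⁻ z, edist z.1 z.2 ^ p ∂(μ'.prod ν') ≤ Metric.ediam s ^ p * (τ * τ) := by
      calc ∫⁻ z, edist z.1 z.2 ^ p ∂(μ'.prod ν')
          ≤ ∫⁻ _, Metric.ediam s ^ p ∂(μ'.prod ν') := by
            refine lintegral_mono_ae ?_
            filter_upwards [hae] with z hz
            exact ENNReal.rpow_le_rpow (Metric.edist_le_ediam_of_mem hz.1 hz.2) hp.le
        _ = _ := by
            rw [lintegral_const, ← Set.univ_prod_univ, Measure.prod_prod, hμ'u, hν'u]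
    rw [h1, zero_add, smul_eq_mul]
    calc τ⁻¹ * ∫⁻ z, edist z.1 z.2 ^ p ∂(μ'.prod ν')
        ≤ τ⁻¹ * (Metric.ediam s ^ p * (τ * τ)) := by gcongr
      _ = Metric.ediam s ^ p * τ * (τ⁻¹ * τ) := by ring
      _ ≤ Metric.ediam s ^ p * τ * 1 := by gcongr; exact ENNReal.inv_mul_le_one τ
      _ = _ := mul_one _

lemma wasserstein_le {E : Type*} [PseudoEMetricSpace E] [MeasurableSpace E]
    (μ ν : Measure E) [IsProbabilityMeasure μ] [IsProbabilityMeasure ν] (h : μ ≪ ν)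
    {s : Set E} (hs : ν sᶜ = 0) {p : ℝ} (hp : 0 < p) :
    wasserstein p μ ν
      ≤ (Metric.ediam s ^ p * ∫⁻ x, (1 - μ.rnDeriv ν x) ∂ν) ^ (1 / p) := by
  obtain ⟨c, hc, hle⟩ := exists_coupling_lintegral_le μ ν h hs hp
  exact ENNReal.rpow_le_rpow ((iInf₂_le c hc).trans hle) (by positivity)

variable {S A : Type*} [MeasurableSpace S] [MeasurableSpace A]

lemma tendsto_wassersteinSup_of_tendsto_klSup {s : Set ℝ} (hb : Metric.ediam s ≠ ∞)
    {p : ℝ} (hp : 0 < p) (Z : Kernel (S × A) ℝ) (Zs : ℕ → Kernel (S × A) ℝ)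
    [IsMarkovKernel Z] [∀ n, IsMarkovKernel (Zs n)] (hZ : ∀ x, Z x sᶜ = 0)
    (h : Tendsto (fun n => klSup (Zs n) Z) atTop (𝓝 0)) :
    Tendsto (fun n => wassersteinSup p (Zs n) Z) atTop (𝓝 0) := by
  have hT : Tendsto (fun n => ⨆ x, ∫⁻ z, (1 - (Zs n x).rnDeriv (Z x) z) ∂(Z x)) atTop (𝓝 0) := by
    rw [ENNReal.tendsto_nhds_zero]
    intro δ hδ
    obtain ⟨ε, hε, hεδ⟩ : ∃ ε : ℝ, 0 < ε ∧ ENNReal.ofReal ε + ENNReal.ofReal ε ≤ δ := by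
      obtain ⟨r, hr0, hrδ⟩ := ENNReal.lt_iff_exists_nnreal_btwn.1 hδ
      have hr : (0 : ℝ) < r := by exact_mod_cast hr0
      refine ⟨r / 2, by positivity, ?_⟩
      rw [← ENNReal.ofReal_add (by positivity) (by positivity), add_halves,
        ENNReal.ofReal_coe_nnreal]
      exact hrδ.le
    have hε' : 0 < ENNReal.ofReal ε := ENNReal.ofReal_pos.2 hε
    -- Divergence at most `ε²` balances the two terms of the Pinsker type bound: `ε + ε²/ε = 2ε ≤
    -- δ`.
    filter_upwards [ENNReal.tendsto_nhds_zero.1 h (ENNReal.ofReal ε * ENNReal.ofReal ε)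
      (ENNReal.mul_pos hε'.ne' hε'.ne')] with n hn
    refine iSup_le fun x => ?_
    have hkl : InformationTheory.klDiv (Zs n x) (Z x) ≤ ENNReal.ofReal ε * ENNReal.ofReal ε :=
      (le_iSup (fun x => InformationTheory.klDiv (Zs n x) (Z x)) x).trans hn
    have hac : Zs n x ≪ Z x := (InformationTheory.klDiv_ne_top_iff.1
      (ne_top_of_le_ne_top (ENNReal.mul_ne_top ENNReal.ofReal_ne_top ENNReal.ofReal_ne_top) hkl)).1
    refine (lintegral_one_sub_rnDeriv_le _ _ hac hε).trans (le_trans ?_ hεδ)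
    gcongr
    exact ENNReal.div_le_of_le_mul hkl
  have hlim : Tendsto (fun n => (Metric.ediam s ^ p *
      ⨆ x, ∫⁻ z, (1 - (Zs n x).rnDeriv (Z x) z) ∂(Z x)) ^ (1 / p)) atTop (𝓝 0) := by
    have h1 := ENNReal.Tendsto.const_mul (a := Metric.ediam s ^ p) hT
      (Or.inr (ENNReal.rpow_ne_top_of_nonneg hp.le hb))
    have h2 := h1.ennrpow_const (1 / p)
    rwa [mul_zero, ENNReal.zero_rpow_of_pos (by positivity)] at h2
  refine tendsto_of_tendsto_of_tendsto_of_le_of_le' tendsto_const_nhds hlim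
    (Eventually.of_forall fun _ => bot_le) ?_
  -- Any finite threshold would do here: it only provides absolute continuity.
  filter_upwards [ENNReal.tendsto_nhds_zero.1 h 1 one_pos] with n hn
  refine iSup_le fun x => ?_
  have hac : Zs n x ≪ Z x := (InformationTheory.klDiv_ne_top_iff.1
    (ne_top_of_le_ne_top ENNReal.one_ne_top
      ((le_iSup (fun x => InformationTheory.klDiv (Zs n x) (Z x)) x).trans hn))).1
  refine (wasserstein_le _ _ hac (hZ x) hp).trans ?_
  gcongr
  exact le_iSup (fun x => ∫⁻ z, (1 - (Zs n x).rnDeriv (Z x) z) ∂(Z x)) x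

end Wasserstein

/-! ### The Bellman operator -/

section Bellman

variable {S A : Type*} [MeasurableSpace S] [MeasurableSpace A]

/-- The joint law of the reward and the next state-action pair. -/
noncomputable def rewardNextPair (K : Kernel (S × A) (ℝ × S)) (π : Kernel S A) (x : S × A) :
    Measure (ℝ × (S × A)) :=
  (K x ⊗ₘ π.comap Prod.snd measurable_snd).map fun q => (q.1.1, (q.1.2, q.2))

variable (K : Kernel (S × A) (ℝ × S)) [IsMarkovKernel K] (π : Kernel S A) [IsMarkovKernel π]

instance (x : S × A) : IsProbabilityMeasure (rewardNextPair K π x) :=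
  Measure.isProbabilityMeasure_map (by fun_prop)

lemma lintegral_rewardNextPair (x : S × A) {f : ℝ × (S × A) → ℝ≥0∞} (hf : Measurable f) :
    ∫⁻ y, f y ∂(rewardNextPair K π x) = ∫⁻ q, ∫⁻ a, f (q.1, (q.2, a)) ∂(π q.2) ∂(K x) := by
  rw [rewardNextPair, lintegral_map hf (by fun_prop), Measure.lintegral_compProd (by fun_prop)]
  rfl

lemma distBellman_apply_eq_map (γ : ℝ) (Z : Kernel (S × A) ℝ) [IsMarkovKernel Z] (x : S × A) :
    distBellman K π γ Z x = (rewardNextPair K π x ⊗ₘ Z.comap Prod.snd measurable_snd).map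
      fun q => q.1.1 + γ * q.2 := by
  have : IsMarkovKernel (nextReturn π Z) := by unfold nextReturn; infer_instance
  refine Measure.ext_of_lintegral _ fun f hf => ?_
  have hg : Measurable fun q : (ℝ × (S × A)) × ℝ => f (q.1.1 + γ * q.2) := by fun_prop
  rw [lintegral_map hf (by fun_prop), Measure.lintegral_compProd hg,
    lintegral_rewardNextPair K π x (hg.lintegral_kernel_prod_right'
      (κ := Z.comap Prod.snd measurable_snd)), distBellman,
    Kernel.lintegral_map _ (by fun_prop) _ hf, Kernel.lintegral_compProd _ _ _ (by fun_prop)]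
  refine lintegral_congr fun q => ?_
  rw [Kernel.prodMkLeft_apply, Kernel.comap_apply, nextReturn,
    Kernel.lintegral_comp _ _ _ (by fun_prop),
    Kernel.lintegral_prod _ _ _ (Measurable.lintegral_kernel (by fun_prop))]
  rw [Kernel.lintegral_id' (by fun_prop)]
  rfl

lemma klSup_distBellman_le (γ : ℝ) (Z₁ Z₂ : Kernel (S × A) ℝ) [IsMarkovKernel Z₁]
    [IsMarkovKernel Z₂] :
    klSup (distBellman K π γ Z₁) (distBellman K π γ Z₂) ≤ klSup Z₁ Z₂ := by
  refine iSup_le fun x => ?_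
  rw [distBellman_apply_eq_map, distBellman_apply_eq_map]
  refine (InformationTheory.klDiv_map_le _ _ (by fun_prop)).trans
    (klDiv_compProd_right_le _ _ _ fun y => ?_)
  exact le_iSup (fun x => InformationTheory.klDiv (Z₁ x) (Z₂ x)) y.2

lemma mean_distBellman (γ : ℝ) (Z : Kernel (S × A) ℝ) [IsMarkovKernel Z] (hZ : HasMean Z)
    (hT : HasMean (distBellman K π γ Z)) (x : S × A) :
    Integrable (fun y => y.1 + γ * mean Z y.2) (rewardNextPair K π x) ∧
      mean (distBellman K π γ Z) x = ∫ y, (y.1 + γ * mean Z y.2) ∂(rewardNextPair K π x) := by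
  have hm : Measurable fun q : (ℝ × (S × A)) × ℝ => q.1.1 + γ * q.2 := by fun_prop
  have hint : Integrable (fun q : (ℝ × (S × A)) × ℝ => q.1.1 + γ * q.2)
      (rewardNextPair K π x ⊗ₘ Z.comap Prod.snd measurable_snd) := by
    have h := hT x
    rw [distBellman_apply_eq_map] at h
    exact h.comp_measurable hm
  have hfib : ∀ y : ℝ × (S × A),
      ∫ z, (y.1 + γ * z) ∂(Z y.2) = y.1 + γ * mean Z y.2 := by
    intro y
    rw [integral_add (integrable_const _) ((hZ y.2).const_mul γ),
      integral_const_mul]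
    simp [mean]
  constructor
  · simpa only [Kernel.prodMkLeft_apply, Kernel.const_apply, Kernel.comap_apply, hfib]
      using Integrable.integral_compProd (κ := Kernel.const Unit (rewardNextPair K π x))
        (η := Kernel.prodMkLeft Unit (Z.comap Prod.snd measurable_snd)) (a := ()) hint
  · rw [mean, distBellman_apply_eq_map, integral_map hm.aemeasurable (by fun_prop),
      Measure.integral_compProd hint]
    simp only [Kernel.comap_apply, hfib]

lemma supNorm_mean_distBellman_sub_le {γ : ℝ} (hγ : 0 ≤ γ) (Z₁ Z₂ : Kernel (S × A) ℝ)
    [IsMarkovKernel Z₁] [IsMarkovKernel Z₂] (h₁ : HasMean Z₁) (h₂ : HasMean Z₂)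
    (hT₁ : HasMean (distBellman K π γ Z₁)) (hT₂ : HasMean (distBellman K π γ Z₂)) :
    supNorm (fun x => mean (distBellman K π γ Z₁) x - mean (distBellman K π γ Z₂) x)
      ≤ ENNReal.ofReal γ * supNorm (fun x => mean Z₁ x - mean Z₂ x) := by
  refine iSup_le fun x => ?_
  obtain ⟨hi₁, he₁⟩ := mean_distBellman K π γ Z₁ h₁ hT₁ x
  obtain ⟨hi₂, he₂⟩ := mean_distBellman K π γ Z₂ h₂ hT₂ x
  beta_reduce
  -- Subtracting under one integral avoids assuming that the reward itself is integrable.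
  rw [he₁, he₂, ← integral_sub hi₁ hi₂]
  set C := ENNReal.ofReal γ * supNorm (fun x => mean Z₁ x - mean Z₂ x) with hC
  calc ‖∫ y, (y.1 + γ * mean Z₁ y.2 - (y.1 + γ * mean Z₂ y.2)) ∂(rewardNextPair K π x)‖ₑ
      ≤ ∫⁻ y, ‖y.1 + γ * mean Z₁ y.2 - (y.1 + γ * mean Z₂ y.2)‖ₑ ∂(rewardNextPair K π x) :=
        enorm_integral_le_lintegral_enorm _
    _ ≤ ∫⁻ _, C ∂(rewardNextPair K π x) := by
        refine lintegral_mono fun y => ?_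
        rw [add_sub_add_left_eq_sub, ← mul_sub, enorm_mul, Real.enorm_eq_ofReal hγ, hC]
        gcongr
        exact le_iSup (fun x => ‖mean Z₁ x - mean Z₂ x‖ₑ) y.2
    _ = C := by simp

lemma hasMean_of_iSup_lintegral_lt_top (Z : Kernel (S × A) ℝ)
    (h : (⨆ x : S × A, ∫⁻ z, ‖z‖ₑ ∂(Z x)) < ∞) : HasMean Z := fun x =>
  ⟨by fun_prop, (le_iSup (fun x => ∫⁻ z, ‖z‖ₑ ∂(Z x)) x).trans_lt h⟩

/-- The next pair is random, so a moment bound uniform over pairs is what keeps the averaged moment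
of `Z` finite. -/
lemma hasMean_distBellman (γ : ℝ) (Z : Kernel (S × A) ℝ) [IsMarkovKernel Z]
    (hK : ∀ x, Integrable (fun q : ℝ × S => q.1) (K x))
    (h : (⨆ x : S × A, ∫⁻ z, ‖z‖ₑ ∂(Z x)) < ∞) : HasMean (distBellman K π γ Z) := by
  intro x
  have hm : Measurable fun q : (ℝ × (S × A)) × ℝ => q.1.1 + γ * q.2 := by fun_prop
  rw [distBellman_apply_eq_map, integrable_map_measure (by fun_prop) hm.aemeasurable]
  refine ⟨by fun_prop, ?_⟩
  set C := ⨆ x : S × A, ∫⁻ z, ‖z‖ₑ ∂(Z x) with hC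
  have hr : ∫⁻ y, ‖y.1‖ₑ ∂(rewardNextPair K π x) = ∫⁻ q, ‖q.1‖ₑ ∂(K x) := by
    rw [lintegral_rewardNextPair K π x (by fun_prop)]
    simp
  calc ∫⁻ q, ‖q.1.1 + γ * q.2‖ₑ ∂(rewardNextPair K π x ⊗ₘ Z.comap Prod.snd measurable_snd)
      = ∫⁻ y, ∫⁻ z, ‖y.1 + γ * z‖ₑ ∂(Z y.2) ∂(rewardNextPair K π x) :=
        Measure.lintegral_compProd (by fun_prop)
    _ ≤ ∫⁻ y, (‖y.1‖ₑ + ‖γ‖ₑ * C) ∂(rewardNextPair K π x) := by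
        refine lintegral_mono fun y => ?_
        calc ∫⁻ z, ‖y.1 + γ * z‖ₑ ∂(Z y.2) ≤ ∫⁻ z, (‖y.1‖ₑ + ‖γ‖ₑ * ‖z‖ₑ) ∂(Z y.2) := by
              refine lintegral_mono fun z => ?_
              rw [← enorm_mul]
              exact enorm_add_le _ _
          _ = ‖y.1‖ₑ + ‖γ‖ₑ * ∫⁻ z, ‖z‖ₑ ∂(Z y.2) := by
              rw [lintegral_add_left measurable_const, lintegral_const_mul _ (by fun_prop)]
              simp
          _ ≤ ‖y.1‖ₑ + ‖γ‖ₑ * C := by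
              gcongr
              exact le_iSup (fun x => ∫⁻ z, ‖z‖ₑ ∂(Z x)) y.2
    _ = ∫⁻ q, ‖q.1‖ₑ ∂(K x) + ‖γ‖ₑ * C := by
        rw [lintegral_add_right _ measurable_const, hr]
        simp
    _ < ∞ := ENNReal.add_lt_top.2 ⟨(hK x).2, ENNReal.mul_lt_top enorm_lt_top h⟩

end Bellman

end DistRL

theorem proposition2 {S A : Type*} [MeasurableSpace S] [MeasurableSpace A]
    (K : Kernel (S × A) (ℝ × S)) [IsMarkovKernel K]
    (π : Kernel S A) [IsMarkovKernel π]
    (γ : ℝ) (hγ0 : 0 ≤ γ) (hγ1 : γ < 1) :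
    -- (1) non-expansiveness
    (∀ (Z₁ Z₂ : Kernel (S × A) ℝ) [IsMarkovKernel Z₁] [IsMarkovKernel Z₂],
      DistRL.klSup (DistRL.distBellman K π γ Z₁) (DistRL.distBellman K π γ Z₂)
        ≤ DistRL.klSup Z₁ Z₂) ∧
    -- (2) convergence in KL divergence implies convergence in Wasserstein distance
    (∀ (X : Set ℝ), IsCompact X → ∀ (p : ℝ), 1 ≤ p →
      ∀ (Z : Kernel (S × A) ℝ) (Zs : ℕ → Kernel (S × A) ℝ)
        [IsMarkovKernel Z] [∀ n, IsMarkovKernel (Zs n)],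
      (∀ x, Z x Xᶜ = 0) → (∀ n x, Zs n x Xᶜ = 0) →
      Tendsto (fun n => DistRL.klSup (Zs n) Z) atTop (𝓝 0) →
      Tendsto (fun n => DistRL.wassersteinSup p (Zs n) Z) atTop (𝓝 0)) ∧
    -- (3) contraction of the expectations, whenever these exist
    (∀ (Z₁ Z₂ : Kernel (S × A) ℝ) [IsMarkovKernel Z₁] [IsMarkovKernel Z₂],
      DistRL.HasMean Z₁ → DistRL.HasMean Z₂ →
      DistRL.HasMean (DistRL.distBellman K π γ Z₁) →
      DistRL.HasMean (DistRL.distBellman K π γ Z₂) →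
      DistRL.supNorm (fun x => DistRL.mean (DistRL.distBellman K π γ Z₁) x
          - DistRL.mean (DistRL.distBellman K π γ Z₂) x)
        ≤ ENNReal.ofReal γ * DistRL.supNorm (fun x => DistRL.mean Z₁ x - DistRL.mean Z₂ x)) ∧
    -- and they exist for integrable rewards and uniformly bounded first absolute moments
    (∀ (Z : Kernel (S × A) ℝ) [IsMarkovKernel Z],
      (∀ x, Integrable (fun q : ℝ × S => q.1) (K x)) →
      (⨆ x : S × A, ∫⁻ z, ‖z‖ₑ ∂(Z x)) < ∞ →
      DistRL.HasMean Z ∧ DistRL.HasMean (DistRL.distBellman K π γ Z)) := by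
  refine ⟨fun Z₁ Z₂ _ _ => DistRL.klSup_distBellman_le K π γ Z₁ Z₂, ?_, ?_, ?_⟩
  · intro X hX p hp Z Zs _ _ hZ _ h
    exact DistRL.tendsto_wassersteinSup_of_tendsto_klSup hX.isBounded.ediam_ne_top
      (one_pos.trans_le hp) Z Zs hZ h
  · intro Z₁ Z₂ _ _ h₁ h₂ hT₁ hT₂
    exact DistRL.supNorm_mean_distBellman_sub_le K π hγ0 Z₁ Z₂ h₁ h₂ hT₁ hT₂
  · intro Z _ hK h
    exact ⟨DistRL.hasMean_of_iSup_lintegral_lt_top Z h,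
      DistRL.hasMean_distBellman K π γ Z hK h⟩
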